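/- Let $l_1,l_2,l_3>0$ be such that there is a convex hyperbolic pentagon $G P_1 Q_1 Q_2 P_2$ with right angles at $P_1,Q_1,Q_2,P_2$, an acute angle at $G$, and side lengths $|GP_1|=l_1$, $|GP_2|=l_2$, $|Q_1Q_2|=l_3$. Write $r_X$ for the rotation by $\pi$ about a point $X$ of the hyperbolic plane. Rotate the pentagon by $r_G$ and extend the sides $P_1Q_1$, $P_2Q_2$ and their images under $r_G$ beyond $P_1$, $P_2$ and their images; this determines a convex pentagon $G P_1 R_1 R_2\, r_G(P_2)$ with right angles at all vertices except possibly $G$, and its image under $r_G$. The four pentagons together form a right-angled octagon. Let $Y$ be the midpoint of its side $Q_1R_1$ (which is perpendicular to $GP_1$) and $O$ the midpoint of its side $Q_2\,r_G(R_2)$ (which is perpendicular to $GP_2$). Set $a=r_Gr_Y$ and $b=r_Gr_O$. Gluing the side through $Y$ to its opposite side by $a$ and the side through $O$ to its opposite side by $b$ gives a one-holed torus with a hyperbolic metric with geodesic boundary, the metric of parameters $(l_1,l_2,l_3)$. Equivalently, the surface is the quotient by $\langle a,b\rangle$ of the union of the translates of the octagon, and its fundamental group is free on $a,b$. For a free homotopy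 class $w$ of closed curves on this surface, let the geometric length $\mathrm{gl}(w)$ be the infimum of the hyperbolic lengths of the curves in $w$, and let the word length $\mathrm{wl}(w)$ be the number of letters of a shortest word in $a,b,a^{-1},b^{-1}$ that represents $w$. **Proposition.** Let $c=\min(2l_1,2l_2,l_3)$. Then $\mathrm{gl}(w)\ge c\cdot \mathrm{wl}(w)$ for every free homotopy class $w$. Consequently, for every $\ell\ge 0$, $$\{w \text{ free homotopy class} : \mathrm{gl}(w)\le \ell\}\subset\{w \text{ free homotopy class} : \mathrm{wl}(w)\le \ell/c\}.$$ -/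

import Mathlib

open scoped UpperHalfPlane ENNReal MatrixGroups unitInterval

noncomputable section

namespace OneHoledTorus

/-! ### Plane hyperbolic geometry, in Mathlib's upper half plane `ℍ` with its hyperbolic distance -/

/-- The position of `q` in the Poincaré disc model centred at `p`. This is a conformal
isometry `ℍ → disc` that takes `p` to `0` and geodesics through `p` to diameters, so the direction
of `disc p q` is the direction in which the geodesic from `p` to `q` leaves `p`. -/
def disc (p q : ℍ) : ℂ := ((q : ℂ) - p) / ((q : ℂ) - (starRingEnd ℂ) (p : ℂ))

/-- The unoriented hyperbolic angle at `p` between the geodesic segments `pq` and `pr`. -/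
def angle (q p r : ℍ) : ℝ := InnerProductGeometry.angle (disc p q) (disc p r)

/-- Positive if `r` lies strictly to the left of the geodesic directed from `p` to `q`,
negative if strictly to its right, zero if on it. -/
def side (p q r : ℍ) : ℝ := ((starRingEnd ℂ) (disc p q) * disc p r).im

/-- `v` lists, in cyclic order (in one of the two directions), the vertices of a strictly convex
polygon: every vertex that is not on an edge lies strictly on the inner side of that edge. -/
def IsConvexPolygon {n : ℕ} [NeZero n] (v : Fin n → ℍ) : Prop :=
  (∀ i j, j ≠ i → j ≠ i + 1 → 0 < side (v i) (v (i + 1)) (v j)) ∨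
  (∀ i j, j ≠ i → j ≠ i + 1 → side (v i) (v (i + 1)) (v j) < 0)

/-- `G P Q Q' P'` is a (convex) hyperbolic pentagon with right angles at all vertices,
except possibly at `G`. -/
structure IsPentagon (G P Q Q' P' : ℍ) : Prop where
  convex : IsConvexPolygon ![G, P, Q, Q', P']
  right_P : angle G P Q = Real.pi / 2
  right_Q : angle P Q Q' = Real.pi / 2
  right_Q' : angle Q Q' P' = Real.pi / 2
  right_P' : angle Q' P' G = Real.pi / 2

/-- `m` is the midpoint of the geodesic segment `pq`. -/
def IsMidpoint (m p q : ℍ) : Prop := dist p m = dist p q / 2 ∧ dist m q = dist p q / 2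

/-- The geodesic segment between `p` and `q`. -/
def geodesicSegment (p q : ℍ) : Set ℍ := {z | dist p z + dist z q = dist p q}

/-- The hyperbolic convex hull of a set. -/
def convHull (s : Set ℍ) : Set ℍ :=
  ⋂₀ {K | s ⊆ K ∧ ∀ p ∈ K, ∀ q ∈ K, geodesicSegment p q ⊆ K}

/-- The hyperbolic rotation by the angle `π` about `z = x + i y`, as an element of `SL(2, ℝ)`
acting on `ℍ` by Möbius transformations. -/
def halfTurn (z : ℍ) : SL(2, ℝ) :=
  ⟨!![z.re / z.im, -(z.re ^ 2 + z.im ^ 2) / z.im; 1 / z.im, -z.re / z.im], by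
    have h : z.im ≠ 0 := z.im_ne_zero
    rw [Matrix.det_fin_two_of]
    field_simp
    ring⟩

/-! ### Closed curves and free homotopy -/

/-- Closed curves in a topological space. -/
def ClosedCurve (X : Type*) [TopologicalSpace X] : Type _ := {f : C(I, X) // f 0 = f 1}

/-- Free homotopy of closed curves: homotopy through closed curves. -/
def freeHomotopy (X : Type*) [TopologicalSpace X] : Setoid (ClosedCurve X) where
  r f g := ContinuousMap.HomotopicWith f.1 g.1 (fun h => h 0 = h 1)
  iseqv :=
    { refl := fun f => ContinuousMap.HomotopicWith.refl f.1 f.2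
      symm := fun h => h.symm
      trans := fun h h' => h.trans h' }

/-- Free homotopy classes of (oriented) closed curves. -/
def FreeHomotopyClass (X : Type*) [TopologicalSpace X] : Type _ := Quotient (freeHomotopy X)

/-! ### The metric with parameters `(l₁, l₂, l₃)` -/

/-- The geometric configuration that defines the metric with parameters `(l₁, l₂, l₃)`.

`G P₁ Q₁ Q₂ P₂` is a pentagon with right angles except at `G`, where the angle is acute; its
sides at `G` have lengths `l₁`, `l₂` and the side opposite to `G` has length `l₃`. The pentagon
is rotated by `π` about `G`. The side `P₁ Q₁` is extended beyond `P₁`, and the side `P₂ Q₂` of the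
rotated pentagon beyond the rotated `P₂`, and this determines the pentagon
`G P₁ R₁ R₂ (r_G P₂)`, whose rotated copy is the last of the four pentagons that make up the
octagon. `Y` and `O` are the midpoints of the sides of the octagon perpendicular to the
segments `G P₁` (at `P₁`) and `G P₂` (at `P₂`). -/
structure Configuration (l₁ l₂ l₃ : ℝ) where
  (G P₁ Q₁ Q₂ P₂ R₁ R₂ Y O : ℍ)
  pentagon : IsPentagon G P₁ Q₁ Q₂ P₂
  length₁ : dist G P₁ = l₁
  length₂ : dist G P₂ = l₂
  length₃ : dist Q₁ Q₂ = l₃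
  acute : angle P₁ G P₂ < Real.pi / 2
  pentagon' : IsPentagon G P₁ R₁ R₂ (halfTurn G • P₂)
  midpoint_Y : IsMidpoint Y Q₁ R₁
  midpoint_O : IsMidpoint O Q₂ (halfTurn G • R₂)

namespace Configuration

variable {l₁ l₂ l₃ : ℝ} (T : Configuration l₁ l₂ l₃)

/-- The right-angled octagon. -/
def octagon : Set ℍ :=
  convHull {T.Q₁, T.Q₂, halfTurn T.G • T.R₂, halfTurn T.G • T.R₁,
    halfTurn T.G • T.Q₁, halfTurn T.G • T.Q₂, T.R₂, T.R₁}

/-- The representation of the free group on `a = 0`, `b = 1` with `a ↦ r_G r_Y`, `b ↦ r_G r_O`.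
The element `r_G r_Y` glues the side of the octagon through `Y` to the opposite side,
and `r_G r_O` glues the side through `O` to the opposite side. -/
def rep : FreeGroup (Fin 2) →* SL(2, ℝ) :=
  FreeGroup.lift ![halfTurn T.G * halfTurn T.Y, halfTurn T.G * halfTurn T.O]

/-- The universal cover of the torus: the union of the translates of the octagon. -/
def cover : Set ℍ := {z | ∃ g : FreeGroup (Fin 2), ∃ x ∈ T.octagon, z = T.rep g • x}

/-- Two points of the universal cover are equivalent if an element of the group maps one to the
other. -/
def deck : Setoid T.cover where
  r x y := ∃ g : FreeGroup (Fin 2), (y : ℍ) = T.rep g • (x : ℍ)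
  iseqv :=
    { refl := fun x => ⟨1, by simp⟩
      symm := by
        rintro x y ⟨g, h⟩
        exact ⟨g⁻¹, by rw [h, map_inv, inv_smul_smul]⟩
      trans := by
        rintro x y z ⟨g, h⟩ ⟨g', h'⟩
        exact ⟨g' * g, by rw [h', h, map_mul, mul_smul]⟩ }

/-- The one-holed torus with geodesic boundary: the octagon with its sides glued by `r_G r_Y` and
`r_G r_O`, in the form of the quotient of the universal cover by the group. -/
def Surface : Type := Quotient T.deck

instance : TopologicalSpace T.Surface := inferInstanceAs (TopologicalSpace (Quotient T.deck))

/-- The covering projection. -/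
def proj : C(T.cover, T.Surface) := ⟨Quotient.mk T.deck, continuous_quotient_mk'⟩

/-- Hyperbolic length of a closed curve on the torus, that is, the hyperbolic length of its lifts to
the universal cover. (All lifts of a curve are translates of each other, hence have the same
length; the infimum picks this common value.) -/
def curveLength (f : ClosedCurve T.Surface) : ℝ≥0∞ :=
  ⨅ (γ : C(I, T.cover)) (_ : T.proj.comp γ = f.1),
    eVariationOn (fun t => (γ t : ℍ)) Set.univ

/-- The geometric length of a free homotopy class: the infimum of the lengths of the closed
curves in the class. -/
def geomLength (w : FreeHomotopyClass T.Surface) : ℝ≥0∞ :=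
  ⨅ (f : ClosedCurve T.Surface) (_ : Quotient.mk (freeHomotopy T.Surface) f = w), T.curveLength f

/-- The word `L` in the letters `a = (0, true)`, `A = (0, false)`, `b = (1, true)`,
`B = (1, false)` represents the free homotopy class `w`: the class contains a curve with a lift
that runs from a point to its image under the group element spelled by `L`. -/
def Represents (L : List (Fin 2 × Bool)) (w : FreeHomotopyClass T.Surface) : Prop :=
  ∃ (f : ClosedCurve T.Surface) (γ : C(I, T.cover)),
    Quotient.mk (freeHomotopy T.Surface) f = w ∧ T.proj.comp γ = f.1 ∧
    (γ 1 : ℍ) = T.rep (FreeGroup.mk L) • (γ 0 : ℍ)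

/-- The word length of a free homotopy class: the number of letters of a shortest word in
`a, b, A, B` that represents it. -/
def wordLength (w : FreeHomotopyClass T.Surface) : ℕ∞ :=
  ⨅ (L : List (Fin 2 × Bool)) (_ : T.Represents L w), (L.length : ℕ∞)

end Configuration

end OneHoledTorus

end

noncomputable section

namespace OneHoledTorus

/-! ### The hyperboloid model -/

/-! The bound is a quantitative ping-pong argument. The four sides of the octagon through `Y`, `O`
and their images under `r_G` bound four half-planes not containing `G`, one for each letter `s`, and
`s` maps the complement of the half-plane of `s⁻¹` onto that of `s`. In the hyperboloid model a
half-plane is a unit spacelike normal, and two of them are at distance at least `c` once their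
normals pair to at most `-cosh c`; `form_sideNormal_le` checks this for all pairs, using the acute
angle at `G`. The segment from `G` to its image under a reduced word of `n` letters then crosses `n
- 1` gaps of width at least `c`. Applied to powers of a cyclically reduced word `L`, this shows that
`L` moves every point by at least `c * L.length` (`length_mul_le_dist_smul`). A lift of a closed
curve joins a point to its image under some group element, which may be taken cyclically reduced
after changing the lift, so the curve is at least that long. -/

/-- The Lorentz form of signature `(2, 1)`, polar to the discriminant of binary quadratic forms. -/
def form (u v : ℝ × ℝ × ℝ) : ℝ := u.2.1 * v.2.1 - (u.1 * v.2.2 + u.2.2 * v.1) / 2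

/-- The determinant of three vectors. -/
def det₃ (u v w : ℝ × ℝ × ℝ) : ℝ :=
  u.1 * (v.2.1 * w.2.2 - v.2.2 * w.2.1) - u.2.1 * (v.1 * w.2.2 - v.2.2 * w.1) +
    u.2.2 * (v.1 * w.2.1 - v.2.1 * w.1)

/-- The point of the hyperboloid that corresponds to a point of the upper half plane. -/
def vec (z : ℍ) : ℝ × ℝ × ℝ := (1 / z.im, z.re / z.im, (z.re ^ 2 + z.im ^ 2) / z.im)

theorem form_comm (u v : ℝ × ℝ × ℝ) : form u v = form v u := by
  simp only [form]; ring

theorem form_add_left (u v w : ℝ × ℝ × ℝ) : form (u + v) w = form u w + form v w := by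
  simp only [form, Prod.fst_add, Prod.snd_add]; ring

theorem form_sub_left (u v w : ℝ × ℝ × ℝ) : form (u - v) w = form u w - form v w := by
  simp only [form, Prod.fst_sub, Prod.snd_sub]; ring

theorem form_smul_left (r : ℝ) (u w : ℝ × ℝ × ℝ) : form (r • u) w = r * form u w := by
  simp only [form, Prod.smul_fst, Prod.smul_snd, smul_eq_mul]; ring

theorem form_add_right (u v w : ℝ × ℝ × ℝ) : form u (v + w) = form u v + form u w := by
  rw [form_comm, form_add_left, form_comm v, form_comm w]

theorem form_sub_right (u v w : ℝ × ℝ × ℝ) : form u (v - w) = form u v - form u w := by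
  rw [form_comm, form_sub_left, form_comm v, form_comm w]

theorem form_smul_right (r : ℝ) (u w : ℝ × ℝ × ℝ) : form u (r • w) = r * form u w := by
  rw [form_comm, form_smul_left, form_comm w]

/-- The Gram determinant of three vectors is nonpositive. -/
theorem gram_det_nonpos (u v w : ℝ × ℝ × ℝ) :
    form u u * (form v v * form w w - form v w ^ 2) -
      form u v * (form u v * form w w - form v w * form u w) +
      form u w * (form u v * form v w - form v v * form u w) ≤ 0 := by
  have : form u u * (form v v * form w w - form v w ^ 2) -
      form u v * (form u v * form w w - form v w * form u w) +
      form u w * (form u v * form v w - form v v * form u w) = -(det₃ u v w ^ 2 / 4) := by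
    simp only [form, det₃]; ring
  rw [this]
  have := sq_nonneg (det₃ u v w)
  linarith

/-- Cramer's relation among the four vectors `p`, `q`, `X`, `Z` of a three-dimensional space, paired
with `u`. -/
theorem det₃_mul_form (p q u X Z : ℝ × ℝ × ℝ) (hp : form u p = 0) (hq : form u q = 0) :
    det₃ p q X * form u Z = det₃ p q Z * form u X := by
  have : det₃ q X Z * form u p - det₃ p X Z * form u q + det₃ p q Z * form u X
      - det₃ p q X * form u Z = 0 := by
    simp only [form, det₃]; ring
  rw [hp, hq] at this
  linarith

/-- Two unit normals of the plane spanned by `p` and `q` agree if they are negative on vectors on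
the same side of that plane. -/
theorem form_eq_of_normal {p q u w X Y : ℝ × ℝ × ℝ} (hup : form u p = 0) (huq : form u q = 0)
    (hwp : form w p = 0) (hwq : form w q = 0) (hu : form u u = 1) (hw : form w w = 1)
    (hX : form u X < 0) (hY : form w Y < 0) (hdet : 0 < det₃ p q X * det₃ p q Y)
    (Z : ℝ × ℝ × ℝ) : form u Z = form w Z := by
  have hXne : det₃ p q X ≠ 0 := by rintro h; simp [h] at hdet
  have hwX : form w X < 0 := by
    have h := det₃_mul_form p q w X Y hwp hwq
    have h' : det₃ p q X ^ 2 * form w Y = det₃ p q X * det₃ p q Y * form w X := by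
      linear_combination det₃ p q X * h
    have : det₃ p q X ^ 2 * form w Y < 0 := mul_neg_of_pos_of_neg (by positivity) hY
    rw [h'] at this
    exact neg_of_mul_neg_right this hdet.le
  -- Both functionals vanish on `p` and `q`, so they are proportional; the unit norms leave only a
  -- sign, which `X` decides.
  have key : ∀ Z, form u Z * form w X = form u X * form w Z := fun Z => by
    have h := det₃_mul_form p q w X Z hwp hwq
    have h' := det₃_mul_form p q u X Z hup huq
    apply mul_left_cancel₀ hXne
    linear_combination form w X * h' - form u X * h
  have h1 := key u
  have h2 := key w
  rw [hu] at h1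
  rw [hw, form_comm u w] at h2
  have hsq : (form w X - form u X) * (form w X + form u X) = 0 := by
    linear_combination form w X * h1 + form u X * h2
  have heq : form w X = form u X := by
    rcases mul_eq_zero.1 hsq with h | h <;> linarith
  have := key Z
  rw [heq, mul_comm] at this
  exact mul_left_cancel₀ hX.ne this

theorem form_vec_self (z : ℍ) : form (vec z) (vec z) = -1 := by
  have := z.im_ne_zero
  simp only [form, vec]; field_simp; ring

theorem cosh_dist_eq (z w : ℍ) : Real.cosh (dist z w) = -form (vec z) (vec w) := by
  have := z.im_ne_zero
  have := w.im_ne_zero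
  rw [UpperHalfPlane.cosh_dist']
  simp only [form, vec]; field_simp; ring

theorem form_vec (z w : ℍ) : form (vec z) (vec w) = -Real.cosh (dist z w) := by
  rw [cosh_dist_eq, neg_neg]

/-- A unit timelike vector in the same half of the light cone as a point of the hyperboloid is a
point of the hyperboloid. -/
theorem exists_vec_eq {w : ℝ × ℝ × ℝ} (hw : form w w = -1) {z : ℍ} (hz : form w (vec z) ≤ 0) :
    ∃ p, vec p = w := by
  obtain ⟨a, b, c⟩ := w
  have hzi := z.im_pos
  simp only [form, vec] at hw hz
  have hac : a * c = 1 + b ^ 2 := by linarith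
  have ha : 0 < a := by
    by_contra! h
    have hane : a ≠ 0 := by rintro rfl; nlinarith
    have ha' : a < 0 := lt_of_le_of_ne h hane
    have h2 : b * (z.re / z.im) - (a * ((z.re ^ 2 + z.im ^ 2) / z.im) + c * (1 / z.im)) / 2
        = (2 * b * z.re - a * (z.re ^ 2 + z.im ^ 2) - c) / (2 * z.im) := by
      field_simp; ring
    rw [h2, div_nonpos_iff] at hz
    have h3 : 2 * b * z.re - a * (z.re ^ 2 + z.im ^ 2) - c ≤ 0 := by
      rcases hz with hz | hz
      · linarith [hz.2]
      · exact hz.1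
    -- Multiplying `h3` by `a < 0` and substituting `a * c = 1 + b ^ 2` gives `(a * x - b) ^ 2 + a ^
    -- 2 * y ^ 2 + 1 ≤ 0`, where `z = x + i y`.
    nlinarith [sq_nonneg (a * z.re - b), mul_nonneg_of_nonpos_of_nonpos ha'.le h3,
      mul_pos hzi hzi, mul_pos (mul_pos_of_neg_of_neg ha' ha') (mul_pos hzi hzi)]
  refine ⟨⟨⟨b / a, 1 / a⟩, by positivity⟩, ?_⟩
  have h1 : UpperHalfPlane.re ⟨⟨b / a, 1 / a⟩, by positivity⟩ = b / a := rfl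
  have h2 : UpperHalfPlane.im ⟨⟨b / a, 1 / a⟩, by positivity⟩ = 1 / a := rfl
  simp only [vec, h1, h2, Prod.mk.injEq]
  refine ⟨by field_simp, by field_simp, ?_⟩
  field_simp
  linarith

/-- On the hyperboloid the half-turn is linear: it fixes `vec z` and is `-1` on the orthogonal
complement. -/
theorem vec_halfTurn_smul (z w : ℍ) :
    vec (halfTurn z • w) = -vec w - (2 * form (vec w) (vec z)) • vec z := by
  have hz := z.im_ne_zero
  have hw := w.im_ne_zero
  have hn : (w.re - z.re) ^ 2 + w.im ^ 2 ≠ 0 := by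
    have := w.im_pos; positivity
  have hc : ((halfTurn z • w : ℍ) : ℂ) = ⟨(z.re * ((w.re - z.re) ^ 2 + w.im ^ 2)
      - z.im ^ 2 * (w.re - z.re)) / ((w.re - z.re) ^ 2 + w.im ^ 2),
      z.im ^ 2 * w.im / ((w.re - z.re) ^ 2 + w.im ^ 2)⟩ := by
    rw [UpperHalfPlane.coe_specialLinearGroup_apply]
    have hne : ((w : ℂ) - z.re) ≠ 0 := by
      intro h
      have := congrArg Complex.im h
      simp at this
      exact hw this
    have hz' : (z.im : ℂ) ≠ 0 := by exact_mod_cast hz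
    have h00 : halfTurn z 0 0 = z.re / z.im := rfl
    have h01 : halfTurn z 0 1 = -(z.re ^ 2 + z.im ^ 2) / z.im := rfl
    have h10 : halfTurn z 1 0 = 1 / z.im := rfl
    have h11 : halfTurn z 1 1 = -z.re / z.im := rfl
    rw [h00, h01, h10, h11]
    change (((z.re / z.im : ℝ) : ℂ) * w + ((-(z.re ^ 2 + z.im ^ 2) / z.im : ℝ) : ℂ)) /
      (((1 / z.im : ℝ) : ℂ) * w + ((-z.re / z.im : ℝ) : ℂ)) = _
    push_cast
    rw [show (z.re / z.im * w + -(z.re ^ 2 + z.im ^ 2) / z.im : ℂ) =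
      (z.re * w - (z.re ^ 2 + z.im ^ 2)) / z.im by ring,
      show (1 / z.im * w + -z.re / z.im : ℂ) = (w - z.re) / z.im by ring,
      div_div_div_cancel_right₀ hz']
    rw [div_eq_iff hne]
    apply Complex.ext
    · simp [pow_two]
      field_simp
      ring
    · simp [pow_two]
      field_simp
      ring
  have hre := congrArg Complex.re hc
  have him := congrArg Complex.im hc
  simp only [UpperHalfPlane.coe_re, UpperHalfPlane.coe_im] at hre him
  simp only [vec, hre, him, form, Prod.ext_iff, Prod.fst_sub, Prod.snd_sub, Prod.fst_neg,
    Prod.snd_neg, Prod.smul_fst, Prod.smul_snd, smul_eq_mul]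
  refine ⟨?_, ?_, ?_⟩ <;> field_simp <;> ring

/-! ### Angles and orientation in terms of the Lorentz form -/

theorem disc_eq (p q : ℍ) : disc p q =
    ⟨((q.re - p.re) ^ 2 + q.im ^ 2 - p.im ^ 2) / ((q.re - p.re) ^ 2 + (q.im + p.im) ^ 2),
      -2 * p.im * (q.re - p.re) / ((q.re - p.re) ^ 2 + (q.im + p.im) ^ 2)⟩ := by
  have hp := p.im_pos
  have hq := q.im_pos
  have hn : (q.re - p.re) ^ 2 + (q.im + p.im) ^ 2 ≠ 0 := by positivity
  have hne : (q : ℂ) - (starRingEnd ℂ) (p : ℂ) ≠ 0 := by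
    intro h
    have := congrArg Complex.im h
    simp at this
    linarith
  rw [disc, div_eq_iff hne]
  apply Complex.ext
  · simp
    field_simp
    ring
  · simp
    field_simp
    ring

/-- Since `disc p q` has norm `tanh (d / 2)`, where `d` is the distance, the factor `1 + cosh d`
rescales it to norm `sinh d` and clears its denominator. -/
theorem one_add_cosh_dist (p q : ℍ) : 1 + Real.cosh (dist p q) =
    ((q.re - p.re) ^ 2 + (q.im + p.im) ^ 2) / (2 * p.im * q.im) := by
  have hp := p.im_ne_zero
  have hq := q.im_ne_zero
  rw [UpperHalfPlane.cosh_dist']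
  field_simp
  ring

/-- The law of cosines. -/
theorem law_of_cosines (p q r : ℍ) :
    (1 + Real.cosh (dist p q)) * (1 + Real.cosh (dist p r)) *
      ((starRingEnd ℂ) (disc p q) * disc p r).re =
    Real.cosh (dist p q) * Real.cosh (dist p r) - Real.cosh (dist q r) := by
  have hp := p.im_pos
  have hq := q.im_pos
  have hr := r.im_pos
  have hn : (q.re - p.re) ^ 2 + (q.im + p.im) ^ 2 ≠ 0 := by positivity
  have hn' : (r.re - p.re) ^ 2 + (r.im + p.im) ^ 2 ≠ 0 := by positivity
  rw [one_add_cosh_dist, one_add_cosh_dist, disc_eq, disc_eq, Complex.mul_re, Complex.conj_re,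
    Complex.conj_im, UpperHalfPlane.cosh_dist', UpperHalfPlane.cosh_dist',
    UpperHalfPlane.cosh_dist']
  field_simp
  ring

theorem side_eq_det₃ (p q r : ℍ) :
    (1 + Real.cosh (dist p q)) * (1 + Real.cosh (dist p r)) * side p q r =
    det₃ (vec p) (vec q) (vec r) / 2 := by
  have hp := p.im_pos
  have hq := q.im_pos
  have hr := r.im_pos
  have hn : (q.re - p.re) ^ 2 + (q.im + p.im) ^ 2 ≠ 0 := by positivity
  have hn' : (r.re - p.re) ^ 2 + (r.im + p.im) ^ 2 ≠ 0 := by positivity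
  rw [one_add_cosh_dist, one_add_cosh_dist, side, disc_eq, disc_eq, Complex.mul_im,
    Complex.conj_re, Complex.conj_im]
  simp only [det₃, vec]
  field_simp
  ring

theorem cosh_dist_of_angle_eq {q p r : ℍ} (h : angle q p r = Real.pi / 2) :
    Real.cosh (dist q r) = Real.cosh (dist p q) * Real.cosh (dist p r) := by
  rw [angle, ← InnerProductGeometry.inner_eq_zero_iff_angle_eq_pi_div_two, Complex.inner,
    mul_comm] at h
  have := law_of_cosines p q r
  rw [h] at this
  linarith

theorem cosh_dist_le_of_angle_lt {q p r : ℍ} (h : angle q p r < Real.pi / 2) :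
    Real.cosh (dist q r) ≤ Real.cosh (dist p q) * Real.cosh (dist p r) := by
  have h1 : 0 ≤ ((starRingEnd ℂ) (disc p q) * disc p r).re := by
    rw [mul_comm, ← Complex.inner, ← InnerProductGeometry.cos_angle_mul_norm_mul_norm]
    refine mul_nonneg (Real.cos_nonneg_of_neg_pi_div_two_le_of_le ?_ h.le) (by positivity)
    linarith [InnerProductGeometry.angle_nonneg (disc p q) (disc p r), Real.pi_pos]
  have h2 := law_of_cosines p q r
  have := Real.one_le_cosh (dist p q)
  have := Real.one_le_cosh (dist p r)
  have : 0 ≤ (1 + Real.cosh (dist p q)) * (1 + Real.cosh (dist p r)) *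
      ((starRingEnd ℂ) (disc p q) * disc p r).re := by positivity
  linarith

theorem det₃_mul_pos_of_side {p q r s : ℍ} (h : 0 < side p q r * side p q s) :
    0 < det₃ (vec p) (vec q) (vec r) * det₃ (vec p) (vec q) (vec s) := by
  have h1 := side_eq_det₃ p q r
  have h2 := side_eq_det₃ p q s
  have : det₃ (vec p) (vec q) (vec r) * det₃ (vec p) (vec q) (vec s) =
      4 * (1 + Real.cosh (dist p q)) ^ 2 * (1 + Real.cosh (dist p r)) *
        (1 + Real.cosh (dist p s)) * (side p q r * side p q s) := by
    linear_combination -2 * det₃ (vec p) (vec q) (vec s) * h1 -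
      4 * (1 + Real.cosh (dist p q)) * (1 + Real.cosh (dist p r)) * side p q r * h2
  rw [this]
  have := Real.one_le_cosh (dist p q)
  have := Real.one_le_cosh (dist p r)
  have := Real.one_le_cosh (dist p s)
  positivity

/-! ### Normals and half-planes -/

/-- The unit normal, pointing away from `g`, of the geodesic through `p` orthogonal to `g p`. -/
def normal (g p : ℍ) : ℝ × ℝ × ℝ :=
  (Real.sinh (dist g p))⁻¹ • (Real.cosh (dist g p) • vec p - vec g)

theorem form_normal (g p z : ℍ) : form (normal g p) (vec z) = (Real.sinh (dist g p))⁻¹ *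
    (Real.cosh (dist g z) - Real.cosh (dist g p) * Real.cosh (dist p z)) := by
  simp only [normal, form_smul_left, form_sub_left, form_vec]
  ring

theorem sinh_dist_pos {g p : ℍ} (h : g ≠ p) : 0 < Real.sinh (dist g p) :=
  Real.sinh_pos_iff.2 (dist_pos.2 h)

theorem form_normal_left {g p : ℍ} (h : g ≠ p) :
    form (normal g p) (vec g) = -Real.sinh (dist g p) := by
  have := sinh_dist_pos h
  rw [form_normal, dist_self, Real.cosh_zero, dist_comm p g]
  field_simp
  linarith [Real.cosh_sq (dist g p)]

theorem form_normal_right (g p : ℍ) : form (normal g p) (vec p) = 0 := by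
  rw [form_normal, dist_self, Real.cosh_zero]
  ring

theorem form_normal_self {g p : ℍ} (h : g ≠ p) : form (normal g p) (normal g p) = 1 := by
  have := sinh_dist_pos h
  conv_lhs => arg 2; rw [normal]
  rw [form_smul_right, form_sub_right, form_smul_right, form_normal_right, form_normal_left h]
  field_simp
  ring

theorem form_normal_of_angle {g p z : ℍ} (h : angle g p z = Real.pi / 2) :
    form (normal g p) (vec z) = 0 := by
  rw [form_normal, cosh_dist_of_angle_eq h, dist_comm p g, sub_self, mul_zero]

/-- The geodesics through `p` and `q` perpendicular to `pq` have `pq` as common perpendicular, and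
the two normals point away from it. -/
theorem form_normal_swap {p q : ℍ} (h : p ≠ q) :
    form (normal p q) (normal q p) = -Real.cosh (dist p q) := by
  have := sinh_dist_pos h
  conv_lhs => arg 2; rw [normal]
  rw [form_smul_right, form_sub_right, form_smul_right, form_normal_right, form_normal_left h,
    dist_comm q p]
  field_simp
  ring

/-- A geodesic that contains two points contains their midpoint. -/
theorem form_eq_zero_of_isMidpoint {m p q : ℍ} (h : IsMidpoint m p q) {n : ℝ × ℝ × ℝ}
    (hp : form n (vec p) = 0) (hq : form n (vec q) = 0) : form n (vec m) = 0 := by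
  set c := Real.cosh (dist p q / 2) with hc
  have hc1 : 1 ≤ c := Real.one_le_cosh _
  have hpm : form (vec p) (vec m) = -c := by rw [form_vec, h.1]
  have hqm : form (vec q) (vec m) = -c := by rw [form_vec, dist_comm, h.2]
  have hpq : form (vec p) (vec q) = -(2 * c ^ 2 - 1) := by
    have h2 := Real.cosh_two_mul (dist p q / 2)
    rw [mul_div_cancel₀ _ two_ne_zero, Real.sinh_sq] at h2
    rw [form_vec, h2, hc]
    ring
  have hqp := form_comm (vec p) (vec q)
  have hmp := form_comm (vec p) (vec m)
  have hmq := form_comm (vec q) (vec m)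
  -- The first vector is null and orthogonal to the timelike `vec m`, so the Gram inequality reduces
  -- to the square of its pairing with `n` being nonpositive.
  have h := gram_det_nonpos (vec p + vec q - (2 * c) • vec m) (vec m) n
  have h0 : form (vec p + vec q - (2 * c) • vec m) (vec p + vec q - (2 * c) • vec m) = 0 := by
    simp only [form_sub_left, form_add_left, form_smul_left, form_sub_right, form_add_right,
      form_smul_right, form_vec_self, ← hqp, ← hmp, ← hmq, hpm, hqm, hpq]
    ring
  have h1 : form (vec p + vec q - (2 * c) • vec m) (vec m) = 0 := by
    simp only [form_sub_left, form_add_left, form_smul_left, form_vec_self, hpm, hqm]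
    ring
  have h2 : form (vec p + vec q - (2 * c) • vec m) n = -(2 * c) * form n (vec m) := by
    rw [form_comm, form_sub_right, form_add_right, form_smul_right, hp, hq]
    ring
  rw [h0, h1, h2, form_vec_self] at h
  have h3 : (2 * c * form n (vec m)) ^ 2 ≤ 0 := by linarith
  have h4 := pow_eq_zero_iff two_ne_zero |>.1 (le_antisymm h3 (sq_nonneg _))
  exact (mul_eq_zero.1 h4).resolve_left (by positivity)

/-- The geodesic segment between points on different sides of a geodesic meets it. -/
theorem exists_form_eq_zero {n : ℝ × ℝ × ℝ} {x y : ℍ} (hx : form n (vec x) ≤ 0)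
    (hy : 0 ≤ form n (vec y)) :
    ∃ z, form n (vec z) = 0 ∧ dist x z + dist z y = dist x y := by
  rcases hx.eq_or_lt with hx | hx
  · exact ⟨x, hx, by simp⟩
  -- The crossing point is the combination of `vec x` and `vec y` orthogonal to `n`, with
  -- coefficients `α, β ≥ 0`; `N` normalizes it.
  set α := form n (vec y) with hα
  obtain ⟨β, hβ⟩ : ∃ β, β = -form n (vec x) := ⟨_, rfl⟩
  have hβ0 : 0 < β := by linarith
  set D := Real.cosh (dist x y) with hD
  have hD1 : 1 ≤ D := Real.one_le_cosh _
  have hN : 0 < α ^ 2 + β ^ 2 + 2 * α * β * D := by positivity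
  obtain ⟨N, hN0, hNs⟩ : ∃ N, 0 < N ∧ N ^ 2 = α ^ 2 + β ^ 2 + 2 * α * β * D :=
    ⟨_, Real.sqrt_pos.2 hN, Real.sq_sqrt hN.le⟩
  have hxy : form (vec x) (vec y) = -D := form_vec x y
  have hyx : form (vec y) (vec x) = -D := by rw [form_comm, hxy]
  have hwx : form (N⁻¹ • (α • vec x + β • vec y)) (vec x) = -((α + β * D) / N) := by
    rw [form_smul_left, form_add_left, form_smul_left, form_smul_left, form_vec_self, hyx]
    ring
  have hwy : form (N⁻¹ • (α • vec x + β • vec y)) (vec y) = -((α * D + β) / N) := by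
    rw [form_smul_left, form_add_left, form_smul_left, form_smul_left, form_vec_self, hxy]
    ring
  obtain ⟨z, hz⟩ := exists_vec_eq (w := N⁻¹ • (α • vec x + β • vec y)) (z := x) (by
    rw [form_smul_right, form_add_right, form_smul_right, form_smul_right, hwx, hwy]
    field_simp
    linarith) (by rw [hwx, neg_nonpos]; positivity)
  refine ⟨z, ?_, ?_⟩
  · rw [hz, form_smul_right, form_add_right, form_smul_right, form_smul_right, ← hα,
      ← neg_eq_iff_eq_neg.2 hβ]
    ring
  have hcx : Real.cosh (dist x z) = (α + β * D) / N := by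
    rw [dist_comm, cosh_dist_eq, hz, hwx, neg_neg]
  have hcy : Real.cosh (dist z y) = (α * D + β) / N := by
    rw [cosh_dist_eq, hz, hwy, neg_neg]
  set S := Real.sinh (dist x y) with hS
  have hS0 : 0 ≤ S := Real.sinh_nonneg_iff.2 dist_nonneg
  have hSD : S ^ 2 = D ^ 2 - 1 := Real.sinh_sq _
  have hsx : Real.sinh (dist x z) = β * S / N := by
    refine (pow_left_inj₀ (Real.sinh_nonneg_iff.2 dist_nonneg) (by positivity) two_ne_zero).1 ?_
    rw [Real.sinh_sq, hcx]
    field_simp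
    rw [hNs, hSD]
    ring
  have hsy : Real.sinh (dist z y) = α * S / N := by
    refine (pow_left_inj₀ (Real.sinh_nonneg_iff.2 dist_nonneg) (by positivity) two_ne_zero).1 ?_
    rw [Real.sinh_sq, hcy]
    field_simp
    rw [hNs, hSD]
    ring
  have hcosh : Real.cosh (dist x z + dist z y) = D := by
    rw [Real.cosh_add, hcx, hcy, hsx, hsy]
    field_simp
    rw [hNs, hSD]
    ring
  exact Real.cosh_injOn (Set.mem_Ici.2 (by positivity)) (Set.mem_Ici.2 dist_nonneg) hcosh

/-- Two half-planes bounded by geodesics at distance at least `c` that both miss a point are at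
distance at least `c`. -/
theorem le_dist_of_form_nonneg {n m : ℝ × ℝ × ℝ} (hn : form n n = 1) (hm : form m m = 1) {c : ℝ}
    (hc : 0 < c) (hnm : form n m ≤ -Real.cosh c) {g : ℍ} (hng : form n (vec g) < 0)
    (hmg : form m (vec g) < 0) {x y : ℍ} (hx : 0 ≤ form n (vec x)) (hy : 0 ≤ form m (vec y)) :
    c ≤ dist x y := by
  obtain ⟨κ, hκ⟩ : ∃ κ, form n m = -κ := ⟨-form n m, by simp⟩
  have hκc : Real.cosh c ≤ κ := by linarith
  have hκ1 : 1 < κ := (Real.one_lt_cosh.2 hc.ne').trans_le hκc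
  have hs2 : 0 < κ ^ 2 - 1 := by nlinarith
  obtain ⟨s, hs, hss⟩ : ∃ s, 0 < s ∧ s ^ 2 = κ ^ 2 - 1 :=
    ⟨_, Real.sqrt_pos.2 hs2, Real.sq_sqrt hs2.le⟩
  have hw : ∀ z : ℍ, form (s⁻¹ • (m + κ • n)) (vec z) =
      (form m (vec z) + κ * form n (vec z)) / s := fun z => by
    rw [form_smul_left, form_add_left, form_smul_left]
    ring
  -- `p` is the foot, on the geodesic of `n`, of its common perpendicular with that of `m`: it is
  -- orthogonal to `n` and pairs to `-s` with `m`. Then `1 ≤ cosh (dist p x)` says that `x` is no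
  -- closer to the geodesic of `m` than `p` is.
  obtain ⟨p, hp⟩ := exists_vec_eq (w := s⁻¹ • (m + κ • n)) (z := g) (by
    simp only [form_smul_left, form_add_left, form_smul_right, form_add_right, hn, hm,
      form_comm m n, hκ]
    field_simp
    linarith) (by
    rw [hw]
    exact div_nonpos_of_nonpos_of_nonneg
      (add_nonpos hmg.le (mul_nonpos_of_nonneg_of_nonpos (by linarith) hng.le)) hs.le)
  have hpx : form m (vec x) + κ * form n (vec x) ≤ -s := by
    have h1 := Real.one_le_cosh (dist p x)
    rw [cosh_dist_eq, hp, hw] at h1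
    have h2 : (form m (vec x) + κ * form n (vec x)) / s ≤ -1 := by linarith
    rw [div_le_iff₀ hs] at h2
    linarith
  have hmx : s ≤ -form m (vec x) := by
    have : 0 ≤ κ * form n (vec x) := mul_nonneg (by linarith) hx
    linarith
  have hD : 1 ≤ Real.cosh (dist x y) := Real.one_le_cosh _
  -- With `D = cosh (dist x y)`, `A = form m (vec x) ≤ -s` and `B = form m (vec y) ≥ 0` this reads
  -- `D ^ 2 ≥ 1 + A ^ 2 + B ^ 2 - 2 * D * A * B`, hence `D ^ 2 ≥ 1 + s ^ 2 = κ ^ 2`.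
  have hgram := gram_det_nonpos (vec x) (vec y) m
  rw [form_vec_self, form_vec_self, hm, form_vec, form_comm _ m, form_comm _ m] at hgram
  have h3 : s ^ 2 ≤ (-form m (vec x)) ^ 2 := pow_le_pow_left₀ hs.le hmx 2
  have h4 : 0 ≤ Real.cosh (dist x y) * (-form m (vec x)) * form m (vec y) :=
    mul_nonneg (mul_nonneg (by linarith) (hs.le.trans hmx)) hy
  have h5 : κ ^ 2 ≤ Real.cosh (dist x y) ^ 2 := by nlinarith [sq_nonneg (form m (vec y))]
  have h6 : κ ≤ Real.cosh (dist x y) := le_of_sq_le_sq h5 (by linarith)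
  have h7 := Real.cosh_le_cosh.1 (hκc.trans h6)
  rwa [abs_of_pos hc, abs_of_nonneg dist_nonneg] at h7

/-! ### A quantitative ping-pong lemma -/

section PingPong

variable {α Γ X : Type*} [Group Γ] [PseudoMetricSpace X] [MulAction Γ X] [IsIsometricSMul Γ X]
  {ρ : FreeGroup α →* Γ} {f : α × Bool → X → ℝ} {c : ℝ} {o : X}

/-- If the half-spaces `0 ≤ f s` have pairwise distance at least `c`, the letter `s` takes the
complement of the half-space of `s⁻¹` to that of `s`, and `o` is outside of all half-spaces, then
a reduced word `s :: L` takes `o` into the half-space of `s`, with distance at least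
`c * L.length` to its complement. -/
theorem pos_and_length_mul_le_dist_of_isReduced (hc : 0 < c)
    (hflip : ∀ s x, f s (ρ (FreeGroup.mk [s]) • x) = -f (s.1, !s.2) x)
    (hsep : ∀ s t, s ≠ t → ∀ x y, 0 ≤ f s x → 0 ≤ f t y → c ≤ dist x y)
    (hcross : ∀ s x y, f s x ≤ 0 → 0 ≤ f s y → ∃ z, f s z = 0 ∧ dist x z + dist z y = dist x y)
    (ho : ∀ s, f s o < 0) (L : List (α × Bool)) (s : α × Bool)
    (hL : FreeGroup.IsReduced (s :: L)) :
    0 < f s (ρ (FreeGroup.mk (s :: L)) • o) ∧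
      ∀ p, f s p ≤ 0 → L.length * c ≤ dist p (ρ (FreeGroup.mk (s :: L)) • o) := by
  induction L generalizing s with
  | nil => exact ⟨by rw [hflip]; linarith [ho (s.1, !s.2)], fun p _ => by simp⟩
  | cons t L ih =>
    obtain ⟨hst, hred⟩ := FreeGroup.isReduced_cons_cons.1 hL
    obtain ⟨hpos, hdist⟩ := ih t hred
    have hne : (s.1, !s.2) ≠ t := by
      rintro rfl
      simp at hst
    -- Positive separation, applied to a single point, makes distinct half-spaces disjoint.
    have hneg : ∀ x, 0 ≤ f t x → f (s.1, !s.2) x < 0 := fun x hx => by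
      by_contra! h
      exact absurd (hsep _ _ hne x x h hx) (by rw [dist_self]; exact hc.not_ge)
    have hneg' : ∀ x, 0 ≤ f (s.1, !s.2) x → f t x < 0 := fun x hx => by
      by_contra! h
      exact absurd (hneg x h) hx.not_gt
    set y := ρ (FreeGroup.mk (t :: L)) • o with hy
    have hmul : ρ (FreeGroup.mk (s :: t :: L)) • o = ρ (FreeGroup.mk [s]) • y := by
      rw [hy, ← mul_smul, ← map_mul, FreeGroup.mul_mk, List.singleton_append]
    have hspos : 0 < f s (ρ (FreeGroup.mk [s]) • y) := by
      rw [hflip]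
      linarith [hneg y hpos.le]
    rw [hmul]
    refine ⟨hspos, fun p hp => ?_⟩
    -- The segment from `p` enters the half-space of `s` at `z`. Pulled back by `s`, the rest leaves
    -- the half-space of `s⁻¹` at `x` and enters that of `t` at `z'`: this gap costs `c`, and
    -- induction covers the part after `z'`.
    obtain ⟨z, hz, hpz⟩ := hcross s p _ hp hspos.le
    set x := (ρ (FreeGroup.mk [s]))⁻¹ • z with hx
    have hzx : z = ρ (FreeGroup.mk [s]) • x := by rw [hx, smul_inv_smul]
    have hfx : f (s.1, !s.2) x = 0 := by
      rw [hzx, hflip] at hz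
      linarith
    obtain ⟨z', hz', hxz⟩ := hcross t x y (hneg' x hfx.ge).le hpos.le
    have h1 := hsep _ _ hne x z' hfx.ge hz'.ge
    have h2 := hdist z' hz'.le
    have h3 : dist z (ρ (FreeGroup.mk [s]) • y) = dist x y := by rw [hzx, dist_smul]
    have h4 : 0 ≤ dist p z := dist_nonneg
    rw [List.length_cons]
    push_cast
    linarith

/-- Powers of a cyclically reduced word are reduced, so `g ^ m` moves `o` by at least `(m * L.length
- 1) * c`, while it moves `x` by at most `m * dist x (g • x)`. The two differ by a bounded amount,
which disappears on division by large `m`. -/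
theorem length_mul_le_dist_smul (hc : 0 < c)
    (hflip : ∀ s x, f s (ρ (FreeGroup.mk [s]) • x) = -f (s.1, !s.2) x)
    (hsep : ∀ s t, s ≠ t → ∀ x y, 0 ≤ f s x → 0 ≤ f t y → c ≤ dist x y)
    (hcross : ∀ s x y, f s x ≤ 0 → 0 ≤ f s y → ∃ z, f s z = 0 ∧ dist x z + dist z y = dist x y)
    (ho : ∀ s, f s o < 0) {L : List (α × Bool)} (hL : FreeGroup.IsCyclicallyReduced L) (x : X) :
    L.length * c ≤ dist x (ρ (FreeGroup.mk L) • x) := by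
  -- The first letter contributes no gap, whence the loss of one `c`; for the empty word the bound
  -- is negative.
  have hred : ∀ M : List (α × Bool), FreeGroup.IsReduced M →
      M.length * c - c ≤ dist o (ρ (FreeGroup.mk M) • o) := by
    rintro (_ | ⟨s, M⟩) hM
    · rw [List.length_nil, Nat.cast_zero, zero_mul, zero_sub]
      linarith [dist_nonneg (x := o) (y := ρ (FreeGroup.mk ([] : List (α × Bool))) • o)]
    · have := (pos_and_length_mul_le_dist_of_isReduced hc hflip hsep hcross ho M s hM).2 o
        (ho s).le
      rw [List.length_cons]
      push_cast
      linarith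
  set g := ρ (FreeGroup.mk L) with hg
  have hpow : ∀ m : ℕ, dist x (g ^ m • x) ≤ m * dist x (g • x) := by
    intro m
    induction m with
    | zero => simp
    | succ m ih =>
      have h1 := dist_triangle x (g ^ m • x) (g ^ (m + 1) • x)
      have h2 : dist (g ^ m • x) (g ^ (m + 1) • x) = dist x (g • x) := by
        rw [pow_succ, mul_smul, dist_smul]
      push_cast
      linarith
  have hbound : ∀ m : ℕ, m * (L.length * c - dist x (g • x)) ≤ c + 2 * dist x o := by
    intro m
    have h1 := hred _ (hL.flatten_replicate m).isReduced
    have h2 : FreeGroup.mk (List.replicate m L).flatten = FreeGroup.mk L ^ m := by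
      rw [FreeGroup.pow_mk]
    have h3 := dist_triangle4 o x (g ^ m • x) (g ^ m • o)
    rw [h2, map_pow, ← hg, List.length_flatten, List.map_replicate, List.sum_replicate,
      smul_eq_mul] at h1
    rw [dist_smul, dist_comm o x] at h3
    push_cast at h1
    linarith [hpow m]
  by_contra! h
  obtain ⟨m, hm⟩ := exists_nat_gt ((c + 2 * dist x o) / (L.length * c - dist x (g • x)))
  rw [div_lt_iff₀ (by linarith)] at hm
  linarith [hbound m]

end PingPong

/-! ### The normals of the octagon -/

theorem det₃_mul_pos_of_isConvexPolygon {n : ℕ} [NeZero n] {v : Fin n → ℍ}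
    (h : IsConvexPolygon v) {i j k : Fin n} (hj : j ≠ i) (hj' : j ≠ i + 1) (hk : k ≠ i)
    (hk' : k ≠ i + 1) :
    0 < det₃ (vec (v i)) (vec (v (i + 1))) (vec (v j)) *
      det₃ (vec (v i)) (vec (v (i + 1))) (vec (v k)) := by
  apply det₃_mul_pos_of_side
  rcases h with h | h
  · exact mul_pos (h i j hj hj') (h i k hk hk')
  · exact mul_pos_of_neg_of_neg (h i j hj hj') (h i k hk hk')

theorem IsConvexPolygon.ne {n : ℕ} [NeZero n] {v : Fin n → ℍ} (h : IsConvexPolygon v)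
    {i j : Fin n} (hj : j ≠ i) (hj' : j ≠ i + 1) : v i ≠ v (i + 1) := by
  intro he
  have := det₃_mul_pos_of_isConvexPolygon h hj hj' hj hj'
  rw [← he] at this
  simp only [det₃] at this
  ring_nf at this
  exact lt_irrefl _ this

/-! ### Trigonometry of pentagons with four right angles -/

theorem angle_comm (q p r : ℍ) : angle q p r = angle r p q :=
  InnerProductGeometry.angle_comm _ _

namespace IsPentagon

variable {G P Q Q' P' : ℍ}

theorem ne_left (h : IsPentagon G P Q Q' P') : G ≠ P :=
  h.convex.ne (i := 0) (j := 2) (by decide) (by decide)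

theorem ne_right (h : IsPentagon G P Q Q' P') : G ≠ P' :=
  (h.convex.ne (i := 4) (j := 1) (by decide) (by decide)).symm

theorem ne_opposite (h : IsPentagon G P Q Q' P') : Q ≠ Q' :=
  h.convex.ne (i := 2) (j := 0) (by decide) (by decide)

/-- The line `PQ` is perpendicular to both `GP` and `QQ'`, and convexity puts `G` and `Q'` on the
same side of it, so the two outward normals coincide. -/
theorem form_normal_eq_left (h : IsPentagon G P Q Q' P') (z : ℝ × ℝ × ℝ) :
    form (normal G P) z = form (normal Q' Q) z := by
  have hdet := det₃_mul_pos_of_isConvexPolygon h.convex (i := 1) (j := 0) (k := 3) (by decide)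
    (by decide) (by decide) (by decide)
  refine form_eq_of_normal (form_normal_right G P) (form_normal_of_angle h.right_P)
    (form_normal_of_angle ?_) (form_normal_right Q' Q) (form_normal_self h.ne_left)
    (form_normal_self h.ne_opposite.symm) ?_ ?_ hdet z
  · rw [angle_comm, h.right_Q]
  · exact (form_normal_left h.ne_left).trans_lt (neg_neg_of_pos (sinh_dist_pos h.ne_left))
  · exact (form_normal_left h.ne_opposite.symm).trans_lt
      (neg_neg_of_pos (sinh_dist_pos h.ne_opposite.symm))

theorem form_normal_eq_right (h : IsPentagon G P Q Q' P') (z : ℝ × ℝ × ℝ) :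
    form (normal G P') z = form (normal Q Q') z := by
  have hdet := det₃_mul_pos_of_isConvexPolygon h.convex (i := 3) (j := 0) (k := 2) (by decide)
    (by decide) (by decide) (by decide)
  refine form_eq_of_normal (form_normal_of_angle ?_) (form_normal_right G P')
    (form_normal_right Q Q') (form_normal_of_angle h.right_Q') (form_normal_self h.ne_right)
    (form_normal_self h.ne_opposite) ?_ ?_ hdet z
  · rw [angle_comm, h.right_P']
  · exact (form_normal_left h.ne_right).trans_lt (neg_neg_of_pos (sinh_dist_pos h.ne_right))
  · exact (form_normal_left h.ne_opposite).trans_lt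
      (neg_neg_of_pos (sinh_dist_pos h.ne_opposite))

theorem form_normal_normal (h : IsPentagon G P Q Q' P') :
    form (normal G P) (normal G P') = -Real.cosh (dist Q Q') := by
  rw [h.form_normal_eq_left, form_comm, h.form_normal_eq_right, form_normal_swap h.ne_opposite]

/-- The pentagon formula is `cosh |QQ'| = sinh |GP| sinh |GP'| - cosh |GP| cosh |GP'| cos G`, and an
acute angle has nonnegative cosine. -/
theorem cosh_opposite_le_sinh_mul_sinh (h : IsPentagon G P Q Q' P')
    (hG : angle P G P' < Real.pi / 2) :
    Real.cosh (dist Q Q') ≤ Real.sinh (dist G P) * Real.sinh (dist G P') := by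
  have h1 := sinh_dist_pos h.ne_left
  have h2 := sinh_dist_pos h.ne_right
  have h3 := cosh_dist_le_of_angle_lt hG
  have h4 := h.form_normal_normal
  rw [normal, normal, form_smul_left, form_smul_right] at h4
  simp only [form_sub_left, form_sub_right, form_smul_left, form_smul_right, form_vec, dist_self,
    Real.cosh_zero, dist_comm P G] at h4
  field_simp at h4
  have h5 := Real.cosh_sq (dist G P)
  have h6 := Real.cosh_sq (dist G P')
  have h7 : 0 ≤ Real.cosh (dist G P) * Real.cosh (dist G P') *
    (Real.cosh (dist G P) * Real.cosh (dist G P') - Real.cosh (dist P P')) :=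
    mul_nonneg (by positivity) (by linarith)
  -- The pentagon formula times `sinh |GP| sinh |GP'|`, with `cos G` expressed through `dist P P'`
  -- by the law of cosines.
  have h8 : Real.sinh (dist G P) * Real.sinh (dist G P') *
      (Real.sinh (dist G P) * Real.sinh (dist G P') - Real.cosh (dist Q Q')) =
      Real.cosh (dist G P) * Real.cosh (dist G P') *
    (Real.cosh (dist G P) * Real.cosh (dist G P') - Real.cosh (dist P P')) := by
    linear_combination -h4 - (Real.cosh (dist G P') ^ 2 - 1) * h5 - Real.sinh (dist G P) ^ 2 * h6
  have h9 := nonneg_of_mul_nonneg_right (h8 ▸ h7) (mul_pos h1 h2)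
  linarith

end IsPentagon

/-! ### Half-turns acting on normals -/

/-- The image of a vector under the rotation by `π` about `z`. -/
def rotate (z : ℍ) (n : ℝ × ℝ × ℝ) : ℝ × ℝ × ℝ := -n - (2 * form n (vec z)) • vec z

theorem form_rotate (z : ℍ) (n m : ℝ × ℝ × ℝ) :
    form (rotate z n) m = -form n m - 2 * form n (vec z) * form m (vec z) := by
  rw [rotate, form_sub_left, form_smul_left, form_comm (vec z) m, ← neg_one_smul ℝ,
    form_smul_left]
  ring

theorem form_rotate_right (z : ℍ) (n m : ℝ × ℝ × ℝ) :
    form m (rotate z n) = -form m n - 2 * form n (vec z) * form m (vec z) := by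
  rw [form_comm, form_rotate, form_comm n]

theorem form_rotate_rotate (z : ℍ) (n m : ℝ × ℝ × ℝ) :
    form (rotate z n) (rotate z m) = form n m := by
  rw [form_rotate, form_rotate_right, form_rotate, form_vec_self]
  ring

theorem form_halfTurn_smul (z w : ℍ) (n : ℝ × ℝ × ℝ) :
    form n (vec (halfTurn z • w)) = form (rotate z n) (vec w) := by
  rw [vec_halfTurn_smul, ← rotate, form_comm, form_rotate, form_rotate, form_comm (vec w) n]
  ring

theorem rotate_rotate (z : ℍ) (n m : ℝ × ℝ × ℝ) :
    form (rotate z (rotate z n)) m = form n m := by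
  rw [form_rotate, form_rotate, form_rotate, form_vec_self]
  ring

/-! ### The four half-planes of the configuration -/

namespace Configuration

variable {l₁ l₂ l₃ : ℝ} (T : Configuration l₁ l₂ l₃)

/-- The outward normal of the side of the octagon shared with its translate by the letter `s`:
the sides through `Y` and `O` are shared with the translates by `a⁻¹` and `b⁻¹`. -/
def sideNormal (s : Fin 2 × Bool) : ℝ × ℝ × ℝ :=
  let n := ![normal T.G T.P₁, normal T.G T.P₂] s.1
  if s.2 then rotate T.G n else n

theorem form_normal_Y : form (normal T.G T.P₁) (vec T.Y) = 0 :=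
  form_eq_zero_of_isMidpoint T.midpoint_Y (form_normal_of_angle T.pentagon.right_P)
    (form_normal_of_angle T.pentagon'.right_P)

theorem form_normal_O : form (normal T.G T.P₂) (vec T.O) = 0 := by
  refine form_eq_zero_of_isMidpoint T.midpoint_O
    (form_normal_of_angle (angle_comm _ _ _ ▸ T.pentagon.right_P')) ?_
  -- `r_G` carries the right angle at `r_G P₂` to one at `P₂`, here in the form of Pythagoras'
  -- relation; so `r_G R₂` lies on the perpendicular to `GP₂`.
  have h := cosh_dist_of_angle_eq T.pentagon'.right_P'
  have e1 : ∀ w : ℍ, Real.cosh (dist T.G (halfTurn T.G • w)) = Real.cosh (dist T.G w) := fun w => by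
    rw [cosh_dist_eq, cosh_dist_eq, form_halfTurn_smul, form_rotate, form_vec_self,
      form_comm (vec w)]
    ring
  have e2 : Real.cosh (dist (halfTurn T.G • T.P₂) T.R₂) =
      Real.cosh (dist T.P₂ (halfTurn T.G • T.R₂)) := by
    rw [cosh_dist_eq, cosh_dist_eq, form_comm, form_halfTurn_smul, form_halfTurn_smul, form_rotate,
      form_rotate, form_comm (vec T.R₂) (vec T.P₂)]
    ring
  rw [e2, dist_comm _ T.G, dist_comm _ T.G, e1] at h
  rw [form_normal, e1, h]
  ring

theorem form_sideNormal_self (s : Fin 2 × Bool) :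
    form (T.sideNormal s) (T.sideNormal s) = 1 := by
  have h1 := form_normal_self T.pentagon.ne_left
  have h2 := form_normal_self T.pentagon.ne_right
  obtain ⟨i, e⟩ := s
  fin_cases i <;> cases e <;> simp [sideNormal, form_rotate_rotate, h1, h2]

theorem form_sideNormal_G (s : Fin 2 × Bool) : form (T.sideNormal s) (vec T.G) < 0 := by
  have h1 := form_normal_left T.pentagon.ne_left
  have h2 := form_normal_left T.pentagon.ne_right
  have h3 := sinh_dist_pos T.pentagon.ne_left
  have h4 := sinh_dist_pos T.pentagon.ne_right
  obtain ⟨i, e⟩ := s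
  fin_cases i <;> cases e <;> 
    simp [sideNormal, form_rotate, form_vec_self, h1, h2, T.pentagon.ne_left,
      T.pentagon.ne_right]

/-- The half-turn about `Y` or `O`, a point on the side, changes the sign of the pairing with that
side's normal; `r_G` then exchanges the side with the opposite one. -/
theorem form_sideNormal_letter (s : Fin 2 × Bool) (x : ℍ) :
    form (T.sideNormal s) (vec (T.rep (FreeGroup.mk [s]) • x)) =
      -form (T.sideNormal (s.1, !s.2)) (vec x) := by
  have hY := T.form_normal_Y
  have hO := T.form_normal_O
  -- As a matrix a half-turn squares to `-1`, so it differs from its inverse, but both act alike on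
  -- `ℍ`.
  have hturn : ∀ (z w : ℍ) (n : ℝ × ℝ × ℝ), form n (vec ((halfTurn z)⁻¹ • w)) =
      form n (vec (halfTurn z • w)) := fun z w n => by
    have h1 := form_halfTurn_smul z ((halfTurn z)⁻¹ • w) (rotate z n)
    rw [smul_inv_smul, rotate_rotate] at h1
    rw [form_halfTurn_smul, h1]
  have hG : ∀ (n : ℝ × ℝ × ℝ) (w : ℍ), form (rotate T.G n) (vec (halfTurn T.G • w)) =
      form n (vec w) := fun n w => by rw [form_halfTurn_smul, rotate_rotate]
  have hflip : ∀ {n : ℝ × ℝ × ℝ} {z : ℍ}, form n (vec z) = 0 → ∀ w : ℍ,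
      form n (vec (halfTurn z • w)) = -form n (vec w) := fun h w => by
    rw [form_halfTurn_smul, form_rotate, h]
    ring
  obtain ⟨i, e⟩ := s
  fin_cases i <;> cases e <;>
    simp [sideNormal, rep, FreeGroup.lift_mk, mul_smul, hturn, hflip hY, hflip hO, hG] <;>
    rw [form_halfTurn_smul]

/-- Opposite sides pair to `-1 - 2 sinh² lᵢ = -cosh (2 lᵢ)`. Of the other pairs, those at distance
`l₃` give `-cosh l₃`, and the rest give `cosh l₃ - 2 sinh l₁ sinh l₂`, at most `-cosh l₃` because
the angle at `G` is acute. -/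
theorem form_sideNormal_le {c : ℝ} (hc : 0 ≤ c) (h₁ : c ≤ 2 * l₁) (h₂ : c ≤ 2 * l₂) (h₃ : c ≤ l₃)
    {s t : Fin 2 × Bool} (hst : s ≠ t) :
    form (T.sideNormal s) (T.sideNormal t) ≤ -Real.cosh c := by
  have hmono : ∀ {l}, c ≤ l → Real.cosh c ≤ Real.cosh l := fun h =>
    Real.cosh_le_cosh.2 (by rwa [abs_of_nonneg hc, abs_of_nonneg (hc.trans h)])
  have e1 := hmono h₁
  have e2 := hmono h₂
  have e3 := hmono h₃
  rw [Real.cosh_two_mul, Real.cosh_sq] at e1 e2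
  have f1 := form_normal_self T.pentagon.ne_left
  have f2 := form_normal_self T.pentagon.ne_right
  have f3 := T.pentagon.form_normal_normal
  have f3' := form_comm (normal T.G T.P₁) (normal T.G T.P₂) ▸ f3
  have g1 := form_normal_left T.pentagon.ne_left
  have g2 := form_normal_left T.pentagon.ne_right
  have k := T.pentagon.cosh_opposite_le_sinh_mul_sinh T.acute
  rw [T.length₁] at g1 k
  rw [T.length₂] at g2 k
  rw [T.length₃] at f3 f3' k
  obtain ⟨i, e⟩ := s
  obtain ⟨j, d⟩ := t
  fin_cases i <;> cases e <;> fin_cases j <;> cases d <;>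
    first
    | exact absurd rfl hst
    | (simp [sideNormal, form_rotate_right, form_rotate, form_vec_self, f1, f2, f3, f3', g1,
        g2, -neg_le_neg_iff, -Real.cosh_le_cosh]
       nlinarith)

theorem min_pos (T : Configuration l₁ l₂ l₃) : 0 < min (min (2 * l₁) (2 * l₂)) l₃ := by
  have h1 := T.length₁ ▸ dist_pos.2 T.pentagon.ne_left
  have h2 := T.length₂ ▸ dist_pos.2 T.pentagon.ne_right
  have h3 := T.length₃ ▸ dist_pos.2 T.pentagon.ne_opposite
  refine lt_min (lt_min ?_ ?_) h3 <;> linarith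

/-- A cyclically reduced word moves every point by at least `min (2 l₁, 2 l₂, l₃)` times its
length. -/
theorem length_mul_le_dist_rep {L : List (Fin 2 × Bool)} (hL : FreeGroup.IsCyclicallyReduced L)
    (x : ℍ) : L.length * min (min (2 * l₁) (2 * l₂)) l₃ ≤
      dist x (T.rep (FreeGroup.mk L) • x) := by
  have hc := T.min_pos
  refine length_mul_le_dist_smul (f := fun s z => form (T.sideNormal s) (vec z)) (o := T.G) hc
    T.form_sideNormal_letter ?_ (fun s x y => exists_form_eq_zero) T.form_sideNormal_G hL x
  intro s t hst x y hx hy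
  refine le_dist_of_form_nonneg (T.form_sideNormal_self s) (T.form_sideNormal_self t) hc
    (T.form_sideNormal_le hc.le ?_ ?_ (min_le_right _ _) hst) (T.form_sideNormal_G s)
    (T.form_sideNormal_G t) hx hy
  · exact (min_le_left _ _).trans (min_le_left _ _)
  · exact (min_le_left _ _).trans (min_le_right _ _)

/-! ### From closed curves to words -/

theorem rep_smul_mem_cover (g : FreeGroup (Fin 2)) {z : ℍ} (hz : z ∈ T.cover) :
    T.rep g • z ∈ T.cover := by
  obtain ⟨h, x, hx, rfl⟩ := hz
  exact ⟨g * h, x, hx, by rw [map_mul, mul_smul]⟩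

/-- The deck transformations. -/
def translate (g : FreeGroup (Fin 2)) : C(T.cover, T.cover) where
  toFun z := ⟨T.rep g • (z : ℍ), T.rep_smul_mem_cover g z.2⟩
  continuous_toFun := ((isometry_smul ℍ (T.rep g)).continuous.comp
    continuous_subtype_val).subtype_mk _

theorem proj_comp_translate (g : FreeGroup (Fin 2)) :
    T.proj.comp (T.translate g) = T.proj := by
  ext z
  exact (Quotient.sound (⟨g, rfl⟩ : T.deck.r z (T.translate g z))).symm

/-- The ends of the lift differ by some `g = k L k⁻¹` with `L` cyclically reduced. Translating by
`k⁻¹` gives another lift of the same curve, with the same distance between its ends, which differ by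
`L`. -/
theorem exists_represents_of_lift (f : ClosedCurve T.Surface) (γ : C(I, T.cover))
    (hγ : T.proj.comp γ = f.1) :
    ∃ L, FreeGroup.IsCyclicallyReduced L ∧
      T.Represents L (Quotient.mk (freeHomotopy T.Surface) f) ∧
      ∃ x : ℍ, dist x (T.rep (FreeGroup.mk L) • x) = dist (γ 0 : ℍ) (γ 1) := by
  have h01 : T.proj (γ 0) = T.proj (γ 1) := by
    have h := f.2
    rw [← hγ] at h
    exact h
  obtain ⟨g, hg⟩ := Quotient.exact h01
  set L := FreeGroup.reduceCyclically g.toWord with hL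
  set k := FreeGroup.mk (FreeGroup.reduceCyclically.conjugator g.toWord) with hk
  have hconj : k * FreeGroup.mk L * k⁻¹ = g := by
    rw [hk, hL, FreeGroup.inv_mk, FreeGroup.mul_mk, FreeGroup.mul_mk,
      FreeGroup.reduceCyclically.conj_conjugator_reduceCyclically, FreeGroup.mk_toWord]
  have hend : ((T.translate k⁻¹).comp γ 1 : ℍ) =
      T.rep (FreeGroup.mk L) • ((T.translate k⁻¹).comp γ 0 : ℍ) := by
    change T.rep k⁻¹ • (γ 1 : ℍ) = T.rep (FreeGroup.mk L) • T.rep k⁻¹ • (γ 0 : ℍ)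
    rw [hg, ← hconj, ← mul_smul, ← mul_smul, ← map_mul, ← map_mul]
    group
  refine ⟨L, FreeGroup.reduceCyclically.isCyclicallyReduced FreeGroup.isReduced_toWord,
    ⟨f, (T.translate k⁻¹).comp γ, rfl, ?_, hend⟩, (T.translate k⁻¹).comp γ 0, ?_⟩
  · rw [← ContinuousMap.comp_assoc, proj_comp_translate, hγ]
  · rw [← hend]
    exact dist_smul (T.rep k⁻¹) (γ 0 : ℍ) (γ 1)

/-- A lift is at least as long as the distance between its ends. A curve without lifts would have
infinite length, an infimum over the empty set, so path lifting is not needed. -/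
theorem ofReal_mul_wordLength_le (w : FreeHomotopyClass T.Surface) :
    ENNReal.ofReal (min (min (2 * l₁) (2 * l₂)) l₃) * (T.wordLength w : ENNReal) ≤
      T.geomLength w := by
  refine le_iInf₂ fun f hf => le_iInf₂ fun γ hγ => ?_
  obtain ⟨L, hL, hrep, x, hx⟩ := T.exists_represents_of_lift f γ hγ
  have h1 : T.wordLength w ≤ (L.length : ℕ∞) := iInf₂_le L (hf ▸ hrep)
  have h2 : (T.wordLength w : ENNReal) ≤ (L.length : ENNReal) := by
    exact_mod_cast ENat.toENNReal_le.2 h1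
  calc _ ≤ ENNReal.ofReal (min (min (2 * l₁) (2 * l₂)) l₃) * (L.length : ENNReal) := by gcongr
    _ = ENNReal.ofReal (L.length * min (min (2 * l₁) (2 * l₂)) l₃) := by
      rw [ENNReal.ofReal_mul (by positivity), ENNReal.ofReal_natCast, mul_comm]
    _ ≤ ENNReal.ofReal (dist (γ 0 : ℍ) (γ 1)) :=
      ENNReal.ofReal_le_ofReal (hx ▸ T.length_mul_le_dist_rep hL x)
    _ = edist (γ 0 : ℍ) (γ 1) := (edist_dist _ _).symm
    _ ≤ _ := eVariationOn.edist_le (fun t => (γ t : ℍ)) (Set.mem_univ 0) (Set.mem_univ 1)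

end Configuration

end OneHoledTorus

end

theorem proposition4p1 (l₁ l₂ l₃ : ℝ) (T : OneHoledTorus.Configuration l₁ l₂ l₃)
    (c : ℝ) (hc : c = min (min (2 * l₁) (2 * l₂)) l₃) :
    (∀ w : OneHoledTorus.FreeHomotopyClass T.Surface,
      ENNReal.ofReal c * (T.wordLength w : ENNReal) ≤ T.geomLength w) ∧
    ∀ ℓ : ℝ,
      {w : OneHoledTorus.FreeHomotopyClass T.Surface | T.geomLength w ≤ ENNReal.ofReal ℓ} ⊆
        {w | (T.wordLength w : ENNReal) ≤ ENNReal.ofReal (ℓ / c)} := by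
  have hpos : 0 < c := hc ▸ T.min_pos
  have hle : ∀ w : OneHoledTorus.FreeHomotopyClass T.Surface,
      ENNReal.ofReal c * (T.wordLength w : ENNReal) ≤ T.geomLength w :=
    hc ▸ T.ofReal_mul_wordLength_le
  refine ⟨hle, fun ℓ w hw => ?_⟩
  change (T.wordLength w : ENNReal) ≤ ENNReal.ofReal (ℓ / c)
  -- For negative `ℓ` both bounds truncate to `0`, so no sign condition is needed.
  rw [ENNReal.ofReal_div_of_pos hpos, ENNReal.le_div_iff_mul_le
    (Or.inl (ENNReal.ofReal_pos.2 hpos).ne') (Or.inl ENNReal.ofReal_ne_top), mul_comm]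
  exact (hle w).trans hw
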